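/- Let $\mathcal K_{\mathrm{IV}}$ be the class of locally compact Hausdorff spaces $P$ such that for every $\sigma$-compact $S\subseteq P$ the complement $P\setminus S$ has an interior point and the point $p_\infty$ of the one-point compactification $\alpha P=P\cup\{p_\infty\}$ is an interior point of $\alpha P\setminus S$ (equivalently, $P$ is not compact and every $\sigma$-compact subset of $P$ has compact closure). Let $P\in\mathcal K_{\mathrm{IV}}$, let $[0,\omega_0]$ be the space of ordinals $\le\omega_0$ with the order topology, and put $$K=(\alpha P\times[0,\omega_0])\setminus\{(p_\infty,\omega_0)\}.$$ Consider $C_0(K)$ (complex-valued functions) as a Hilbert $C^*$-module over itself with $\langle x,y\rangle=\overline{x}\,y$; its multiplier module is $C_b(K)$, and $\langle x,y\rangle=\overline{x}\,y\in C_0(K)$ for $x\in C_0(K)$, $y\in C_b(K)$. A sequence $X=(x_i)_{i\ge1}$ in $C_b(K)$ is called admissible if $\|x_i\|\le1$ for all $i$ and, for every $x\in C_0(K)$, the series $\sum_i\langle x,x_i\rangle\langle x_i,x\rangle$ converges in norm in $C_0(K)$ with sum at most $\langle x,x\rangle$. For an admissible $X$ and a sequence $\Phi=(\varphi_k)_{k\ge1}$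 of states (positive linear functionals of norm $1$) on $C_0(K)$ put $$d_{X,\Phi}(x,y)=\Big(\sup_k\sum_{i=k}^\infty|\varphi_k(\langle x-y,x_i\rangle)|^2\Big)^{1/2},\qquad x,y\in C_0(K).$$ A set $Y\subseteq C_0(K)$ is $(C_b(K),C_0(K))$-totally bounded if for all such $X$, $\Phi$ and all $\varepsilon>0$ there are finitely many $y_1,\dots,y_n\in Y$ such that every $y\in Y$ satisfies $d_{X,\Phi}(y_j,y)<\varepsilon$ for some $j$; it is $(C_0(K),C_0(K))$-totally bounded if this holds for all admissible $X$ with members in $C_0(K)$. A bounded operator $F:\mathcal M\to\mathcal N$ of Hilbert $C_0(K)$-modules is $C_0(K)$-compact if it lies in the operator-norm closure of the linear span of the operators $z\mapsto x\langle y,z\rangle$, $x\in\mathcal N$, $y\in\mathcal M$. Then the closed unit ball of $C_0(K)$ is $(C_b(K),C_0(K))$-totally bounded, but the identity operator $C_0(K)\to C_0(K)$ is not $C_0(K)$-compact. Consequently Troitsky's criterion fails for the module $C_0(K)$: it is not true that an adjointable operator $F$ from a Hilbert $C_0(K)$-module $\mathcal M$ to $C_0(K)$ is always $C_0(K)$-compact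 if and only if the image under $F$ of the unit ball of $\mathcal M$ is totally bounded, whether total boundedness is understood in the $(C_b(K),C_0(K))$-sense or in the $(C_0(K),C_0(K))$-sense. -/

import Mathlib

open scoped ZeroAtInfty ComplexOrder BoundedContinuousFunction

universe u

/-! ### The spaces -/

/-- The class of locally compact Hausdorff spaces in which the complement of every σ-compact subset
has an inner point and, in the one-point compactification, the point at infinity is always inner
for that complement. (Equivalently: the space is locally compact Hausdorff, not compact, and every
σ-compact subset has compact closure.) -/
structure IsKIV (P : Type u) [TopologicalSpace P] : Prop where
  locallyCompact : LocallyCompactSpace P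
  t2 : T2Space P
  nonempty_interior_compl : ∀ S : Set P, IsSigmaCompact S → (interior Sᶜ).Nonempty
  infty_mem_interior_compl : ∀ S : Set P, IsSigmaCompact S →
    (OnePoint.infty : OnePoint P) ∈ interior (((↑) : P → OnePoint P) '' S)ᶜ

/-- The space `αP × [0, ω₀]` without its corner `(p_∞, ω₀)`. The space `[0, ω₀]` of all ordinals
`≤ ω₀` is `ℕ∞` with its order topology. -/
abbrev DeletedPlank (P : Type u) [TopologicalSpace P] : Type u :=
  {q : OnePoint P × ℕ∞ // q ≠ (OnePoint.infty, ⊤)}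

/-! ### The order of the C⋆-algebra `C₀(X)` -/

/-- The order on `C₀(X, ℂ)`: `f ≤ g` iff `g - f` is pointwise real and nonnegative. -/
noncomputable instance zeroAtInftyPartialOrder (X : Type u) [TopologicalSpace X] : PartialOrder C₀(X, ℂ) :=
  PartialOrder.lift (fun f : C₀(X, ℂ) => (f : X → ℂ)) DFunLike.coe_injective

/-- The pointwise order is the order of the C⋆-algebra `C₀(X, ℂ)`. -/
instance zeroAtInftyStarOrderedRing (X : Type u) [TopologicalSpace X] :
    StarOrderedRing C₀(X, ℂ) := by
  refine StarOrderedRing.of_nonneg_iff' (fun {x y} hxy z t => add_le_add le_rfl (hxy t))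
    (fun f => ⟨fun hf => ?_, ?_⟩)
  · refine ⟨⟨⟨fun t => ((Real.sqrt (f t).re : ℝ) : ℂ), by fun_prop⟩, ?_⟩, ?_⟩
    · have h : Filter.Tendsto (fun t => ((Real.sqrt (f t).re : ℝ) : ℂ)) (Filter.cocompact X)
          (nhds ((Real.sqrt (0 : ℂ).re : ℝ) : ℂ)) :=
        (Continuous.tendsto (by fun_prop : Continuous fun z : ℂ => ((Real.sqrt z.re : ℝ) : ℂ))
          0).comp f.zero_at_infty'
      simpa using h
    · ext t
      have ht : 0 ≤ f t := hf t
      obtain ⟨h1, h2⟩ := Complex.nonneg_iff.1 ht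
      change f t = star ((Real.sqrt (f t).re : ℝ) : ℂ) * ((Real.sqrt (f t).re : ℝ) : ℂ)
      rw [Complex.star_def, Complex.conj_ofReal, ← Complex.ofReal_mul, Real.mul_self_sqrt h1]
      exact Complex.ext rfl (by simp [← h2])
  · rintro ⟨s, rfl⟩ t
    exact star_mul_self_nonneg (s t)

noncomputable section

/-! ### Operators between Hilbert C⋆-modules -/

section Operators

variable (A : Type*) [NonUnitalCStarAlgebra A] [PartialOrder A] [StarOrderedRing A]
  {M N : Type*} [NormedAddCommGroup M] [NormedSpace ℂ M] [SMul A M] [CStarModule A M]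
  [NormedAddCommGroup N] [NormedSpace ℂ N] [SMul A N] [CStarModule A N]

/-- `F : M → N` has an adjoint with respect to the `A`-valued inner products. -/
def IsAdjointable (F : M →L[ℂ] N) : Prop :=
  ∃ G : N →L[ℂ] M, ∀ (x : M) (y : N), inner A (F x) y = inner A x (G y)

/-- The elementary `A`-compact operators `θ_{x,y} : z ↦ x⟨y, z⟩`, for `x ∈ N` and `y ∈ M`. -/
def elementaryCompact (M N : Type*) [NormedAddCommGroup M] [NormedSpace ℂ M] [SMul A M]
    [CStarModule A M] [NormedAddCommGroup N] [NormedSpace ℂ N] [SMul A N] [CStarModule A N] :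
    Set (M →L[ℂ] N) :=
  {θ | ∃ (x : N) (y : M), ∀ z : M, θ z = inner A y z • x}

/-- `F` lies in the operator-norm closure of the linear span of the elementary `A`-compact
operators. -/
def IsACompact (F : M →L[ℂ] N) : Prop :=
  F ∈ closure (Submodule.span ℂ (elementaryCompact A M N) : Set (M →L[ℂ] N))

end Operators

/-- A state: a positive linear functional of norm one. -/
structure IsState {A : Type*} [NonUnitalCStarAlgebra A] [PartialOrder A] (φ : A →L[ℂ] ℂ) :
    Prop where
  nonneg : ∀ a : A, 0 ≤ a → 0 ≤ φ a
  norm_eq_one : ‖φ‖ = 1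

/-! ### The uniform structure on `C₀(X)` -/

section Uniform

variable {X : Type u} [TopologicalSpace X]

/-- The inner product `⟨x, y⟩` of `x ∈ C₀(X)` with an element `y` of the multiplier module `C_b(X)`.
It lies in `C₀(X)`, and extends the inner product of the Hilbert `C₀(X)`-module `C₀(X)`. -/
def outerInner (x : C₀(X, ℂ)) (y : X →ᵇ ℂ) : C₀(X, ℂ) where
  toFun t := y t * star (x t)
  continuous_toFun := by fun_prop
  zero_at_infty' := by
    refine squeeze_zero_norm (a := fun t => ‖y‖ * ‖x t‖) (fun t => ?_) ?_
    · rw [norm_mul, norm_star]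
      exact mul_le_mul_of_nonneg_right (y.norm_coe_le_norm t) (norm_nonneg _)
    · simpa using (x.zero_at_infty'.norm).const_mul ‖y‖

/-- The sequence `ξ` of elements of `C_b(X)` is admissible for `C₀(X)`: for every `x ∈ C₀(X)` the
series `∑ᵢ ⟨x, ξᵢ⟩⟨ξᵢ, x⟩` converges in `C₀(X)` and its sum is at most `⟨x, x⟩`, and `‖ξᵢ‖ ≤ 1`. -/
structure IsAdmissible (ξ : ℕ → X →ᵇ ℂ) : Prop where
  hasSum_le : ∀ x : C₀(X, ℂ), ∃ s : C₀(X, ℂ),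
    HasSum (fun i => outerInner x (ξ i) * star (outerInner x (ξ i))) s ∧
      s ≤ inner C₀(X, ℂ) x x
  norm_le_one : ∀ i, ‖ξ i‖ ≤ 1

open scoped ENNReal in
/-- The pseudometric `d_{ξ,φ}(x, y) = (sup_k ∑_{i ≥ k} |φ_k(⟨x - y, ξᵢ⟩)|²)^{1/2}`. -/
def admDist (ξ : ℕ → X →ᵇ ℂ) (φ : ℕ → C₀(X, ℂ) →L[ℂ] ℂ) (x y : C₀(X, ℂ)) : ℝ≥0∞ :=
  (⨆ k : ℕ, ∑' j : ℕ, ‖φ k (outerInner (x - y) (ξ (k + j)))‖ₑ ^ 2) ^ (1 / 2 : ℝ)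

/-- `Y ⊆ C₀(X)` is totally bounded for the uniform structure given by all the pseudometrics
`d_{ξ,φ}`, with `φ` a sequence of states on `C₀(X)` and `ξ` an admissible sequence with members in
`V`. For `V = C_b(X)` this is `(C_b(X), C₀(X))`-total boundedness (outer admissible systems), for
`V = C₀(X)` it is `(C₀(X), C₀(X))`-total boundedness. -/
def IsTroitskyTotallyBounded (V : Set (X →ᵇ ℂ)) (Y : Set C₀(X, ℂ)) : Prop :=
  ∀ ξ : ℕ → X →ᵇ ℂ, IsAdmissible ξ → (∀ i, ξ i ∈ V) →
    ∀ φ : ℕ → C₀(X, ℂ) →L[ℂ] ℂ, (∀ k, IsState (φ k)) →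
      ∀ ε : ℝ, 0 < ε → ∃ t : Finset C₀(X, ℂ), (t : Set C₀(X, ℂ)) ⊆ Y ∧
        ∀ y ∈ Y, ∃ z ∈ t, admDist ξ φ z y < ENNReal.ofReal ε

end Uniform

/-- Troitsky's criterion for the Hilbert `C₀(X)`-module `C₀(X)`: an adjointable operator `F` from a
Hilbert `C₀(X)`-module `M` to `C₀(X)` is `C₀(X)`-compact if and only if the image of the unit ball
of `M` is totally bounded. -/
def TroitskyCriterion (X : Type u) [TopologicalSpace X] (V : Set (X →ᵇ ℂ)) : Prop :=
  ∀ (M : Type u) [NormedAddCommGroup M] [NormedSpace ℂ M] [CompleteSpace M] [SMul C₀(X, ℂ) M]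
    [CStarModule C₀(X, ℂ) M] (F : M →L[ℂ] C₀(X, ℂ)), IsAdjointable C₀(X, ℂ) F →
      (IsACompact C₀(X, ℂ) F ↔
        IsTroitskyTotallyBounded V (F '' Metric.closedBall (0 : M) 1))

end

/-!
Write `K` for the deleted plank. Every Gδ set of `αP` containing `p_∞` is a neighbourhood of `p_∞`,
because its complement is σ-compact in `P`. So a continuous map from `K` to a first countable
Hausdorff space is constant near `p_∞` on all levels `αP × {n}` simultaneously, and by density
of `ℕ` in `[0, ω₀]` its range is already the image of a compact set `T`. Apply this to an admissible
sequence `ξ`, viewed as a map `K → ℂ^ℕ`, and test admissibility on a function equal to `1` on `T`: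
the series `∑ |ξᵢ|²` converges uniformly on `K`. Together with a Bessel inequality for functionals,
this makes the pseudometric `d_{ξ,φ}` on a bounded set uniformly approximable by one coming from a
linear map to a finite-dimensional space, where bounded sets are totally bounded.

On the other hand the `A`-compact operators on a C⋆-algebra `A` are the multiplications by elements
of `A`, so the identity is `A`-compact only if `A` has a unit; for `A = C₀(K)` this fails since `K`
is not compact.
-/

open Filter Topology

section ZeroAtInfty

variable {X : Type*} [TopologicalSpace X]

theorem zeroAtInfty_sum_apply {ι β : Type*} [TopologicalSpace β] [AddCommMonoid β] [ContinuousAdd β]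
    (s : Finset ι) (a : ι → C₀(X, β)) (t : X) : (∑ i ∈ s, a i) t = ∑ i ∈ s, a i t :=
  map_sum ({ toFun f := f t, map_zero' := rfl, map_add' _ _ := rfl } : C₀(X, β) →+ β) a s

theorem norm_zeroAtInfty_apply_le {β : Type*} [SeminormedAddCommGroup β] (x : C₀(X, β)) (t : X) :
    ‖x t‖ ≤ ‖x‖ :=
  x.toBCF.norm_coe_le_norm t

theorem norm_zeroAtInfty_le_of_forall {β : Type*} [SeminormedAddCommGroup β] {x : C₀(X, β)} {c : ℝ}
    (hc : 0 ≤ c) (h : ∀ t, ‖x t‖ ≤ c) : ‖x‖ ≤ c :=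
  (BoundedContinuousFunction.norm_le (f := x.toBCF) hc).2 h

theorem exists_zeroAtInfty_eqOn_one [RegularSpace X] [LocallyCompactSpace X] {T : Set X}
    (hT : IsCompact T) : ∃ h : C₀(X, ℂ), Set.EqOn h 1 T := by
  obtain ⟨f, hf, -, hsupp, -⟩ :=
    exists_continuous_one_zero_of_isCompact hT isClosed_empty (Set.disjoint_empty T)
  have hsupp' : HasCompactSupport fun t => (f t : ℂ) :=
    hsupp.comp_left (g := fun r : ℝ => (r : ℂ)) Complex.ofReal_zero
  refine ⟨⟨⟨fun t => (f t : ℂ), by fun_prop⟩, hsupp'.is_zero_at_infty⟩, fun t ht => ?_⟩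
  exact congrArg Complex.ofReal (hf ht)

end ZeroAtInfty

section Bessel

variable {X ι : Type*} [TopologicalSpace X]

theorem norm_sum_mul_star (s : Finset ι) (z : ι → ℂ) :
    ‖∑ i ∈ s, z i * star (z i)‖ = ∑ i ∈ s, ‖z i‖ ^ 2 := by
  have hcast : ∑ i ∈ s, z i * star (z i) = ((∑ i ∈ s, ‖z i‖ ^ 2 : ℝ) : ℂ) := by
    simp [Complex.mul_conj']
  rw [hcast, Complex.norm_of_nonneg (by positivity)]

theorem norm_sum_smul_sq_le (s : Finset ι) (c : ι → ℂ) (a : ι → C₀(X, ℂ)) :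
    ‖∑ i ∈ s, c i • a i‖ ^ 2 ≤ (∑ i ∈ s, ‖c i‖ ^ 2) * ‖∑ i ∈ s, a i * star (a i)‖ := by
  rw [← Real.le_sqrt (norm_nonneg _) (by positivity)]
  refine norm_zeroAtInfty_le_of_forall (Real.sqrt_nonneg _) fun t => Real.le_sqrt_of_sq_le ?_
  calc ‖(∑ i ∈ s, c i • a i) t‖ ^ 2 = ‖∑ i ∈ s, c i * a i t‖ ^ 2 := by
        rw [zeroAtInfty_sum_apply]; rfl
    _ ≤ (∑ i ∈ s, ‖c i‖ * ‖a i t‖) ^ 2 := by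
        gcongr
        exact norm_sum_le_of_le s fun i _ => (norm_mul _ _).le
    _ ≤ (∑ i ∈ s, ‖c i‖ ^ 2) * ∑ i ∈ s, ‖a i t‖ ^ 2 := Finset.sum_mul_sq_le_sq_mul_sq _ _ _
    _ = (∑ i ∈ s, ‖c i‖ ^ 2) * ‖(∑ i ∈ s, a i * star (a i)) t‖ := by
        rw [← norm_sum_mul_star s (a · t), zeroAtInfty_sum_apply]; rfl
    _ ≤ (∑ i ∈ s, ‖c i‖ ^ 2) * ‖∑ i ∈ s, a i * star (a i)‖ := by
        gcongr
        exact norm_zeroAtInfty_apply_le _ t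

theorem sum_norm_sq_apply_le (φ : C₀(X, ℂ) →L[ℂ] ℂ) (s : Finset ι) (a : ι → C₀(X, ℂ)) :
    ∑ i ∈ s, ‖φ (a i)‖ ^ 2 ≤ ‖φ‖ ^ 2 * ‖∑ i ∈ s, a i * star (a i)‖ := by
  -- `b` is chosen so that `φ b` is the sum to be estimated, which then cancels.
  set S := ∑ i ∈ s, ‖φ (a i)‖ ^ 2 with hS
  set b := ∑ i ∈ s, star (φ (a i)) • a i
  have hφb : ‖φ b‖ = S := by
    simp only [b, map_sum, map_smul, smul_eq_mul, mul_comm (star _), norm_sum_mul_star, hS]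
  have hb : ‖b‖ ^ 2 ≤ S * ‖∑ i ∈ s, a i * star (a i)‖ := by
    simpa only [norm_star] using norm_sum_smul_sq_le s (fun i => star (φ (a i))) a
  have hS_sq : S * S ≤ S * (‖φ‖ ^ 2 * ‖∑ i ∈ s, a i * star (a i)‖) := by
    calc S * S = ‖φ b‖ ^ 2 := by rw [hφb, sq]
      _ ≤ (‖φ‖ * ‖b‖) ^ 2 := by gcongr; exact φ.le_opNorm b
      _ = ‖φ‖ ^ 2 * ‖b‖ ^ 2 := mul_pow _ _ _
      _ ≤ ‖φ‖ ^ 2 * (S * ‖∑ i ∈ s, a i * star (a i)‖) := by gcongr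
      _ = S * (‖φ‖ ^ 2 * ‖∑ i ∈ s, a i * star (a i)‖) := mul_left_comm _ _ _
  rcases (show 0 ≤ S by positivity).eq_or_lt with hS0 | hS0
  · rw [← hS0]
    positivity
  · exact le_of_mul_le_mul_left hS_sq hS0

end Bessel

section OuterInner

variable {X : Type u} {ι : Type*} [TopologicalSpace X]

theorem outerInner_apply (x : C₀(X, ℂ)) (y : X →ᵇ ℂ) (t : X) :
    outerInner x y t = y t * star (x t) := rfl

theorem outerInner_sub (x x' : C₀(X, ℂ)) (y : X →ᵇ ℂ) :
    outerInner (x - x') y = outerInner x y - outerInner x' y := by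
  ext t
  simp [outerInner_apply, mul_sub]

theorem norm_outerInner_le (x : C₀(X, ℂ)) (y : X →ᵇ ℂ) : ‖outerInner x y‖ ≤ ‖y‖ * ‖x‖ := by
  refine norm_zeroAtInfty_le_of_forall (by positivity) fun t => ?_
  rw [outerInner_apply, norm_mul, norm_star]
  gcongr
  exacts [y.norm_coe_le_norm t, norm_zeroAtInfty_apply_le x t]

theorem sum_outerInner_mul_star (x : C₀(X, ℂ)) (ξ : ι → X →ᵇ ℂ) (s : Finset ι) :
    ∑ i ∈ s, outerInner x (ξ i) * star (outerInner x (ξ i)) =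
      outerInner x (∑ i ∈ s, ξ i * star (ξ i)) * x := by
  ext t
  simp only [zeroAtInfty_sum_apply, ZeroAtInftyContinuousMap.mul_apply,
    ZeroAtInftyContinuousMap.star_apply, outerInner_apply, BoundedContinuousFunction.sum_apply,
    BoundedContinuousFunction.mul_apply, BoundedContinuousFunction.star_apply, Finset.sum_mul,
    star_mul', star_star]
  exact Finset.sum_congr rfl fun i _ => by ring

theorem sum_norm_sq_apply_outerInner_le (φ : C₀(X, ℂ) →L[ℂ] ℂ) (x : C₀(X, ℂ)) (ξ : ι → X →ᵇ ℂ)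
    (s : Finset ι) :
    ∑ i ∈ s, ‖φ (outerInner x (ξ i))‖ ^ 2 ≤ (‖φ‖ * ‖x‖) ^ 2 * ‖∑ i ∈ s, ξ i * star (ξ i)‖ := by
  calc ∑ i ∈ s, ‖φ (outerInner x (ξ i))‖ ^ 2
      ≤ ‖φ‖ ^ 2 * ‖outerInner x (∑ i ∈ s, ξ i * star (ξ i)) * x‖ := by
        rw [← sum_outerInner_mul_star]
        exact sum_norm_sq_apply_le φ s _
    _ ≤ ‖φ‖ ^ 2 * (‖∑ i ∈ s, ξ i * star (ξ i)‖ * ‖x‖ * ‖x‖) := by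
        gcongr
        refine (norm_mul_le _ _).trans ?_
        gcongr
        exact norm_outerInner_le _ _
    _ = (‖φ‖ * ‖x‖) ^ 2 * ‖∑ i ∈ s, ξ i * star (ξ i)‖ := by ring

theorem admDist_le_of_forall_sum_le {ξ : ℕ → X →ᵇ ℂ} {φ : ℕ → C₀(X, ℂ) →L[ℂ] ℂ} {x y : C₀(X, ℂ)}
    {c : ℝ} (hc : 0 ≤ c)
    (h : ∀ k, ∀ s : Finset ℕ, (∀ i ∈ s, k ≤ i) →
      ∑ i ∈ s, ‖φ k (outerInner (x - y) (ξ i))‖ ^ 2 ≤ c ^ 2) :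
    admDist ξ φ x y ≤ ENNReal.ofReal c := by
  have hsup : ⨆ k : ℕ, ∑' j : ℕ, ‖φ k (outerInner (x - y) (ξ (k + j)))‖ₑ ^ 2 ≤
      ENNReal.ofReal c ^ 2 := by
    refine iSup_le fun k => ENNReal.summable.tsum_le_of_sum_le fun s => ?_
    have hs := h k (s.map (addLeftEmbedding k)) (by simp)
    rw [Finset.sum_map] at hs
    calc ∑ j ∈ s, ‖φ k (outerInner (x - y) (ξ (k + j)))‖ₑ ^ 2
        = ENNReal.ofReal (∑ j ∈ s, ‖φ k (outerInner (x - y) (ξ (k + j)))‖ ^ 2) := by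
          rw [ENNReal.ofReal_sum_of_nonneg fun _ _ => by positivity]
          simp only [ENNReal.ofReal_pow (norm_nonneg _), ofReal_norm]
      _ ≤ ENNReal.ofReal (c ^ 2) := ENNReal.ofReal_le_ofReal hs
      _ = ENNReal.ofReal c ^ 2 := ENNReal.ofReal_pow hc 2
  calc admDist ξ φ x y ≤ (ENNReal.ofReal c ^ 2) ^ (1 / 2 : ℝ) :=
        ENNReal.rpow_le_rpow hsup (by norm_num)
    _ = ENNReal.ofReal c := by
        rw [← ENNReal.rpow_two, ← ENNReal.rpow_mul]
        norm_num

theorem admDist_le_add_of_head_of_tail {ξ : ℕ → X →ᵇ ℂ} {φ : ℕ → C₀(X, ℂ) →L[ℂ] ℂ}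
    {x y : C₀(X, ℂ)} {n : ℕ} {a b : ℝ} (ha : 0 ≤ a) (hb : 0 ≤ b)
    (hhead : ∀ k < n, ∑ i ∈ Finset.range n, ‖φ k (outerInner (x - y) (ξ i))‖ ^ 2 ≤ a ^ 2)
    (htail : ∀ k, ∀ s : Finset ℕ, (∀ i ∈ s, n ≤ i) →
      ∑ i ∈ s, ‖φ k (outerInner (x - y) (ξ i))‖ ^ 2 ≤ b ^ 2) :
    admDist ξ φ x y ≤ ENNReal.ofReal (a + b) := by
  refine admDist_le_of_forall_sum_le (by positivity) fun k s hs => ?_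
  rcases lt_or_ge k n with hk | hk
  · have hlow : ∑ i ∈ s with i < n, ‖φ k (outerInner (x - y) (ξ i))‖ ^ 2 ≤ a ^ 2 :=
      (Finset.sum_le_sum_of_subset_of_nonneg (fun i hi => by simp_all)
        fun _ _ _ => by positivity).trans (hhead k hk)
    have hhigh := htail k (s.filter (¬ · < n)) fun i hi => not_lt.1 (Finset.mem_filter.1 hi).2
    rw [← Finset.sum_filter_add_sum_filter_not s (· < n)]
    nlinarith
  · nlinarith [htail k s fun i hi => hk.trans (hs i hi)]

end OuterInner

section TotallyBounded

variable {X : Type u} [TopologicalSpace X]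

theorem exists_finset_subset_forall_dist_lt {E F : Type*} [PseudoMetricSpace F] [ProperSpace F]
    {L : E → F} {Y : Set E} (hL : Bornology.IsBounded (L '' Y)) {δ : ℝ} (hδ : 0 < δ) :
    ∃ t : Finset E, (t : Set E) ⊆ Y ∧ ∀ y ∈ Y, ∃ z ∈ t, dist (L z) (L y) < δ := by
  have hLY : TotallyBounded (L '' Y) := hL.isCompact_closure.totallyBounded.subset subset_closure
  obtain ⟨t, htY, htfin, hcover⟩ := Set.exists_subset_image_finite_and.1
    (Metric.finite_approx_of_totallyBounded hLY δ hδ)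
  refine ⟨htfin.toFinset, by simpa using htY, fun y hy => ?_⟩
  have hmem := hcover (Set.mem_image_of_mem L hy)
  simp only [Set.biUnion_image, Set.mem_iUnion₂, Metric.mem_ball'] at hmem
  simpa using hmem

theorem exists_finset_subset_forall_sum_le {ι : Type*} [Finite ι] (φ : ι → C₀(X, ℂ) →L[ℂ] ℂ)
    (ξ : ℕ → X →ᵇ ℂ) (n : ℕ) {Y : Set C₀(X, ℂ)} (hY : Bornology.IsBounded Y) {δ : ℝ} (hδ : 0 < δ) :
    ∃ t : Finset C₀(X, ℂ), (t : Set C₀(X, ℂ)) ⊆ Y ∧ ∀ y ∈ Y, ∃ z ∈ t, ∀ k,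
      ∑ i ∈ Finset.range n, ‖φ k (outerInner (z - y) (ξ i))‖ ^ 2 ≤ δ ^ 2 := by
  have := Fintype.ofFinite ι
  let L (x : C₀(X, ℂ)) (k : ι) : EuclideanSpace ℂ (Fin n) :=
    WithLp.toLp 2 fun i => φ k (outerInner x (ξ i))
  have norm_L_sq (x : C₀(X, ℂ)) (k : ι) :
      ‖L x k‖ ^ 2 = ∑ i ∈ Finset.range n, ‖φ k (outerInner x (ξ i))‖ ^ 2 := by
    rw [EuclideanSpace.norm_sq_eq, Finset.sum_range]
  have L_sub (x y : C₀(X, ℂ)) : L (x - y) = L x - L y := by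
    ext k i
    simp [L, outerInner_sub]
  have hbdd : Bornology.IsBounded (L '' Y) := by
    obtain ⟨C, hC⟩ := hY.exists_norm_le
    refine Bornology.forall_isBounded_image_eval_iff.1 fun k => ?_
    refine isBounded_iff_forall_norm_le.2
      ⟨√((‖φ k‖ * C) ^ 2 * ‖∑ i ∈ Finset.range n, ξ i * star (ξ i)‖), ?_⟩
    rintro _ ⟨_, ⟨x, hx, rfl⟩, rfl⟩
    refine Real.le_sqrt_of_sq_le ?_
    rw [Function.eval, norm_L_sq]
    refine (sum_norm_sq_apply_outerInner_le _ _ _ _).trans ?_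
    gcongr
    exact hC x hx
  obtain ⟨t, htY, ht⟩ := exists_finset_subset_forall_dist_lt hbdd hδ
  refine ⟨t, htY, fun y hy => ?_⟩
  obtain ⟨z, hz, hzy⟩ := ht y hy
  refine ⟨z, hz, fun k => ?_⟩
  rw [← norm_L_sq, L_sub, Pi.sub_apply, ← dist_eq_norm]
  gcongr
  exact (dist_le_pi_dist _ _ k).trans hzy.le

theorem exists_nat_forall_norm_sum_lt {E : Type*} [SeminormedAddCommGroup E] {f : ℕ → E}
    (hf : Summable f) {ε : ℝ} (hε : 0 < ε) :
    ∃ n, ∀ s : Finset ℕ, (∀ i ∈ s, n ≤ i) → ‖∑ i ∈ s, f i‖ < ε := by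
  obtain ⟨u, hu⟩ := hf.vanishing (Metric.ball_mem_nhds 0 hε)
  obtain ⟨n, hn⟩ := u.exists_nat_subset_range
  refine ⟨n, fun s hs => mem_ball_zero_iff.1 (hu s (Finset.disjoint_left.2 fun i his hiu => ?_))⟩
  exact (hs i his).not_gt (Finset.mem_range.1 (hn hiu))

theorem exists_finset_admDist_lt {ξ : ℕ → X →ᵇ ℂ} (hξ : Summable fun i => ξ i * star (ξ i))
    {φ : ℕ → C₀(X, ℂ) →L[ℂ] ℂ} (hφ : ∀ k, ‖φ k‖ ≤ 1) {Y : Set C₀(X, ℂ)}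
    (hY : Bornology.IsBounded Y) {ε : ℝ} (hε : 0 < ε) :
    ∃ t : Finset C₀(X, ℂ), (t : Set C₀(X, ℂ)) ⊆ Y ∧
      ∀ y ∈ Y, ∃ z ∈ t, admDist ξ φ z y < ENNReal.ofReal ε := by
  obtain ⟨C, hC0, hC⟩ := hY.exists_pos_norm_le
  obtain ⟨n, hn⟩ := exists_nat_forall_norm_sum_lt hξ (ε := (ε / (8 * C)) ^ 2) (by positivity)
  obtain ⟨t, htY, ht⟩ := exists_finset_subset_forall_sum_le (fun k : Fin n => φ k) ξ n hY
    (δ := ε / 4) (by positivity)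
  refine ⟨t, htY, fun y hy => ?_⟩
  obtain ⟨z, hz, hhead⟩ := ht y hy
  have hzy : ‖z - y‖ ≤ 2 * C := (norm_sub_le _ _).trans (by linarith [hC z (htY hz), hC y hy])
  have htail (k : ℕ) (s : Finset ℕ) (hs : ∀ i ∈ s, n ≤ i) :
      ∑ i ∈ s, ‖φ k (outerInner (z - y) (ξ i))‖ ^ 2 ≤ (ε / 4) ^ 2 := by
    calc _ ≤ (‖φ k‖ * ‖z - y‖) ^ 2 * ‖∑ i ∈ s, ξ i * star (ξ i)‖ :=
          sum_norm_sq_apply_outerInner_le _ _ _ _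
      _ ≤ (1 * (2 * C)) ^ 2 * (ε / (8 * C)) ^ 2 := by
          gcongr
          exacts [hφ k, (hn s hs).le]
      _ = (ε / 4) ^ 2 := by field
  refine ⟨z, hz, (admDist_le_add_of_head_of_tail (by positivity) (by positivity)
    (fun k hk => hhead ⟨k, hk⟩) htail).trans_lt ?_⟩
  exact (ENNReal.ofReal_lt_ofReal_iff hε).2 (by linarith)

theorem IsAdmissible.summable_mul_star [RegularSpace X] [LocallyCompactSpace X] {ξ : ℕ → X →ᵇ ℂ}
    (hξ : IsAdmissible ξ) {T : Set X} (hT : IsCompact T)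
    (hrange : (Set.range fun t i => ξ i t) ⊆ (fun t i => ξ i t) '' T) :
    Summable fun i => ξ i * star (ξ i) := by
  obtain ⟨h, h_one⟩ := exists_zeroAtInfty_eqOn_one hT
  obtain ⟨S, hS, -⟩ := hξ.hasSum_le h
  have norm_sum_le (s : Finset ℕ) : ‖∑ i ∈ s, ξ i * star (ξ i)‖ ≤
      ‖∑ i ∈ s, outerInner h (ξ i) * star (outerInner h (ξ i))‖ := by
    refine (BoundedContinuousFunction.norm_le (norm_nonneg _)).2 fun t => ?_
    obtain ⟨t', ht', htt'⟩ := hrange ⟨t, rfl⟩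
    have heq : (∑ i ∈ s, ξ i * star (ξ i)) t =
        (∑ i ∈ s, outerInner h (ξ i) * star (outerInner h (ξ i))) t' := by
      simp [sum_outerInner_mul_star, outerInner_apply, h_one ht', ← congrFun htt']
    rw [heq]
    exact norm_zeroAtInfty_apply_le _ t'
  refine summable_iff_vanishing_norm.2 fun η hη => ?_
  obtain ⟨u, hu⟩ := summable_iff_vanishing_norm.1 hS.summable η hη
  exact ⟨u, fun s hs => (norm_sum_le s).trans_lt (hu s hs)⟩

theorem isTroitskyTotallyBounded_of_isBounded [RegularSpace X] [LocallyCompactSpace X]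
    (hX : ∀ f : X → ℕ → ℂ, Continuous f → ∃ T, IsCompact T ∧ Set.range f ⊆ f '' T)
    (V : Set (X →ᵇ ℂ)) {Y : Set C₀(X, ℂ)} (hY : Bornology.IsBounded Y) :
    IsTroitskyTotallyBounded V Y := by
  intro ξ hξ _ φ hφ ε hε
  obtain ⟨T, hT, hrange⟩ := hX (fun t i => ξ i t) (by fun_prop)
  exact exists_finset_admDist_lt (hξ.summable_mul_star hT hrange) (fun k => (hφ k).norm_eq_one.le)
    hY hε

end TotallyBounded

section Compactness

theorem IsACompact.exists_eq_mul_right {A : Type*} [NonUnitalCStarAlgebra A] [PartialOrder A]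
    [StarOrderedRing A] {θ : A →L[ℂ] A} (hθ : IsACompact A θ) : ∃ a, ∀ z, θ z = z * a := by
  have hclosed : IsClosed (Set.range (ContinuousLinearMap.mul ℂ A).flip) :=
    (ContinuousLinearMap.isometry_mul_flip ℂ A).isClosedEmbedding.isClosed_range
  have hspan : Submodule.span ℂ (elementaryCompact A A A) ≤
      LinearMap.range (ContinuousLinearMap.mul ℂ A).flip.toLinearMap := by
    refine Submodule.span_le.2 ?_
    rintro θ ⟨x, y, hxy⟩
    refine ⟨star y * x, ContinuousLinearMap.ext fun z => ?_⟩
    exact (mul_assoc z (star y) x).symm.trans (hxy z).symm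
  obtain ⟨a, rfl⟩ := closure_minimal hspan hclosed hθ
  exact ⟨a, fun z => rfl⟩

variable {X : Type u} [TopologicalSpace X]

theorem not_isACompact_id [RegularSpace X] [LocallyCompactSpace X] [NoncompactSpace X] :
    ¬ IsACompact C₀(X, ℂ) (ContinuousLinearMap.id ℂ C₀(X, ℂ)) := by
  intro hid
  obtain ⟨a, ha⟩ := hid.exists_eq_mul_right
  have ha_one (t : X) : a t = 1 := by
    obtain ⟨z, hz⟩ := exists_zeroAtInfty_eqOn_one (isCompact_singleton (x := t))
    have hzt : z t = z t * a t := congrArg (· t) (ha z)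
    simpa [hz rfl] using hzt.symm
  exact one_ne_zero (tendsto_nhds_unique (tendsto_const_nhds.congr fun t => (ha_one t).symm)
    a.zero_at_infty')

theorem not_troitskyCriterion {V : Set (X →ᵇ ℂ)}
    (htb : IsTroitskyTotallyBounded V (Metric.closedBall (0 : C₀(X, ℂ)) 1))
    (hid : ¬ IsACompact C₀(X, ℂ) (ContinuousLinearMap.id ℂ C₀(X, ℂ))) :
    ¬ TroitskyCriterion X V := by
  intro hcrit
  have hadj : IsAdjointable C₀(X, ℂ) (ContinuousLinearMap.id ℂ C₀(X, ℂ)) :=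
    ⟨ContinuousLinearMap.id ℂ C₀(X, ℂ), fun _ _ => rfl⟩
  refine hid ((hcrit C₀(X, ℂ) _ hadj).2 ?_)
  simpa using htb

end Compactness

namespace DeletedPlank

variable {P : Type u} [TopologicalSpace P]

/-- The point `(p, m)` of the part `P × [0, ω₀]` of the deleted plank. -/
def ofPoint (p : P) (m : ℕ∞) : DeletedPlank P :=
  ⟨(p, m), by simp⟩

/-- The point `(p, n)` of the part `αP × [0, ω₀)` of the deleted plank. -/
def ofLevel (p : OnePoint P) (n : ℕ) : DeletedPlank P :=
  ⟨(p, n), by simp⟩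

theorem continuous_ofPoint : Continuous fun q : P × ℕ∞ => ofPoint q.1 q.2 :=
  ((OnePoint.continuous_coe.comp continuous_fst).prodMk continuous_snd).subtype_mk _

theorem continuous_ofLevel (n : ℕ) : Continuous fun p : OnePoint P => ofLevel p n :=
  (continuous_id.prodMk continuous_const).subtype_mk _

theorem eq_ofPoint_or_eq_ofLevel_infty (q : DeletedPlank P) :
    (∃ p m, q = ofPoint p m) ∨ ∃ n, q = ofLevel OnePoint.infty n := by
  obtain ⟨⟨p, m⟩, hq⟩ := q
  induction p using OnePoint.rec with
  | coe p => exact .inl ⟨p, m, rfl⟩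
  | infty =>
    induction m using ENat.recTopCoe with
    | top => exact absurd rfl hq
    | coe n => exact .inr ⟨n, rfl⟩

theorem apply_ofPoint_eq_of_forall_nat {Y : Type*} [TopologicalSpace Y] [T2Space Y]
    {f : DeletedPlank P → Y} (hf : Continuous f) {p q : P}
    (h : ∀ n : ℕ, f (ofPoint p n) = f (ofPoint q n)) (m : ℕ∞) :
    f (ofPoint p m) = f (ofPoint q m) := by
  have hlim (r : P) : Tendsto (fun n : ℕ => f (ofPoint r n)) atTop (𝓝 (f (ofPoint r ⊤))) :=
    ((hf.comp continuous_ofPoint).tendsto (r, ⊤)).comp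
      (tendsto_const_nhds.prodMk_nhds ENat.tendsto_natCast_nhds_top)
  induction m using ENat.recTopCoe with
  | coe n => exact h n
  | top => exact tendsto_nhds_unique (hlim p) ((hlim q).congr fun n => (h n).symm)

instance [WeaklyLocallyCompactSpace P] [T2Space P] : LocallyCompactSpace (DeletedPlank P) :=
  isOpen_ne.isOpenEmbedding_subtypeVal.locallyCompactSpace

instance : NoncompactSpace (DeletedPlank P) := by
  refine not_compactSpace_iff.1 fun _ => ?_
  have hcompact : IsCompact ((fun q : DeletedPlank P => q.1.2) '' {q | q.1.1 = OnePoint.infty}) :=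
    (OnePoint.isClosed_infty.preimage (by fun_prop)).isCompact.image (by fun_prop)
  obtain ⟨q, hq, hq'⟩ := hcompact.isClosed.mem_of_tendsto ENat.tendsto_natCast_nhds_top
    (.of_forall fun n => ⟨ofLevel OnePoint.infty n, rfl, rfl⟩)
  exact q.2 (Prod.ext hq hq')

end DeletedPlank

namespace IsKIV

open DeletedPlank

variable {P : Type u} [TopologicalSpace P]

theorem noncompactSpace (hP : IsKIV P) : NoncompactSpace P := by
  refine not_compactSpace_iff.1 fun _ => ?_
  simpa using hP.nonempty_interior_compl Set.univ isCompact_univ.isSigmaCompact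

theorem mem_nhds_infty_of_isGδ (hP : IsKIV P) {s : Set (OnePoint P)} (hs : IsGδ s)
    (hmem : OnePoint.infty ∈ s) : s ∈ 𝓝 OnePoint.infty := by
  obtain ⟨U, hUo, rfl⟩ := hs.eq_iInter_nat
  have hσ : IsSigmaCompact (⋃ n, ((↑) ⁻¹' U n : Set P)ᶜ) :=
    isSigmaCompact_iUnion_of_isCompact _ fun n =>
      ((OnePoint.isOpen_iff_of_mem (Set.mem_iInter.1 hmem n)).1 (hUo n)).2
  refine mem_of_superset (mem_interior_iff_mem_nhds.1 (hP.infty_mem_interior_compl _ hσ)) ?_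
  intro p hp
  induction p using OnePoint.rec with
  | infty => exact hmem
  | coe p => simpa using hp

theorem eventually_forall_eq_infty (hP : IsKIV P) {ι Y : Type*} [Countable ι] [TopologicalSpace Y]
    [FirstCountableTopology Y] [T1Space Y] {g : ι → OnePoint P → Y} (hg : ∀ i, Continuous (g i)) :
    ∀ᶠ p in 𝓝 OnePoint.infty, ∀ i, g i p = g i OnePoint.infty := by
  have hGδ : IsGδ (⋂ i, g i ⁻¹' {g i OnePoint.infty}) :=
    .iInter fun i => (IsGδ.singleton _).preimage (hg i)
  filter_upwards [hP.mem_nhds_infty_of_isGδ hGδ (by simp)] with p hp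
  simpa using hp

theorem exists_isCompact_range_subset_image (hP : IsKIV P) {Y : Type*} [TopologicalSpace Y]
    [FirstCountableTopology Y] [T2Space Y] {f : DeletedPlank P → Y} (hf : Continuous f) :
    ∃ T, IsCompact T ∧ Set.range f ⊆ f '' T := by
  have hev := hP.eventually_forall_eq_infty fun n => hf.comp (continuous_ofLevel n)
  obtain ⟨Q, ⟨-, hQ⟩, hQ_eq⟩ := (OnePoint.hasBasis_nhds_infty.mem_iff).1 hev
  have hlevel {p : P} (hp : p ∉ Q) (n : ℕ) : f (ofLevel p n) = f (ofLevel OnePoint.infty n) :=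
    hQ_eq (.inl ⟨p, hp, rfl⟩) n
  have := hP.noncompactSpace
  obtain ⟨p₀, hp₀⟩ := (Set.ne_univ_iff_exists_notMem Q).1 hQ.ne_univ
  refine ⟨(fun q : P × ℕ∞ => ofPoint q.1 q.2) '' (insert p₀ Q ×ˢ Set.univ),
    ((hQ.insert p₀).prod isCompact_univ).image continuous_ofPoint, ?_⟩
  rintro _ ⟨q, rfl⟩
  rw [Set.image_image]
  obtain ⟨p, m, rfl⟩ | ⟨n, rfl⟩ := q.eq_ofPoint_or_eq_ofLevel_infty
  · by_cases hp : p ∈ Q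
    · exact ⟨(p, m), ⟨.inr hp, trivial⟩, rfl⟩
    · exact ⟨(p₀, m), ⟨.inl rfl, trivial⟩, apply_ofPoint_eq_of_forall_nat hf
        (fun n => (hlevel hp₀ n).trans (hlevel hp n).symm) m⟩
  · exact ⟨(p₀, n), ⟨.inl rfl, trivial⟩, hlevel hp₀ n⟩

end IsKIV

theorem mainTheorem5 (P : Type u) [TopologicalSpace P] (hP : IsKIV P) :
    IsTroitskyTotallyBounded Set.univ
        (Metric.closedBall (0 : C₀(DeletedPlank P, ℂ)) 1) ∧
      ¬ IsACompact C₀(DeletedPlank P, ℂ)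
          (ContinuousLinearMap.id ℂ C₀(DeletedPlank P, ℂ)) ∧
      ¬ TroitskyCriterion (DeletedPlank P) Set.univ ∧
      ¬ TroitskyCriterion (DeletedPlank P)
          (Set.range (ZeroAtInftyContinuousMap.toBCF : C₀(DeletedPlank P, ℂ) → _)) := by
  have := hP.locallyCompact
  have := hP.t2
  have htb (V) : IsTroitskyTotallyBounded V (Metric.closedBall (0 : C₀(DeletedPlank P, ℂ)) 1) :=
    isTroitskyTotallyBounded_of_isBounded
      (fun _ hf => hP.exists_isCompact_range_subset_image hf) V Metric.isBounded_closedBall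
  exact ⟨htb _, not_isACompact_id, not_troitskyCriterion (htb _) not_isACompact_id,
    not_troitskyCriterion (htb _) not_isACompact_id⟩
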